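/- Consider a DC power grid: a finite connected simple graph whose nodes are $n\ge 1$ loads ($L$) and $m\ge 1$ sources ($S$), in which each line $i\sim j$ has a conductance $w_{ij}=w_{ji}>0$, and assume that the loads together with the lines between loads form a connected graph. Let $Y\in\mathbb R^{(n+m)\times(n+m)}$ be the Kirchhoff matrix, $Y_{ii}=\sum_{k\sim i}w_{ik}$, $Y_{ij}=-w_{ij}$ if $i\ne j$ and $i\sim j$, and $Y_{ij}=0$ otherwise, and let $Y_{LL}$, $Y_{LS}$ be its load-load and load-source blocks. Fix source voltages $V_S\in\mathbb R^m$ with $V_S>0$, and put $\mathcal I_L^*:=-Y_{LS}V_S$ and $V_L^*:=Y_{LL}^{-1}\mathcal I_L^*$. Write $[x]=\operatorname{diag}(x)$; vector and matrix inequalities are element-wise. Define $P_c:\mathbb R^n\to\mathbb R^n$ by $P_c(V_L)=[V_L]Y_{LL}(V_L^*-V_L)$. A vector $\tilde P_c\in\mathbb R^n$ of power demands is feasible if there is $V_L\in\mathbb R^n$ with $V_L>0$ and $[V_L]Y_{LL}(V_L-V_L^*)+\tilde P_c=0$; such a $V_L$ is called an operating point associated to $\tilde P_c$. Let $\mathcal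 F\subset\mathbb R^n$ be the set of feasible power demands. Let $\mathcal D$ be the set of long-term voltage stable operating points, i.e. of those operating points $V_L>0$ (associated to some power demand) at which the Jacobian matrix of $P_c$ is nonsingular and has an inverse all of whose elements are negative. For $\lambda\in\mathbb R^n$ let $h(\lambda)=\tfrac12([\lambda]Y_{LL}+Y_{LL}[\lambda])$, let $\Lambda=\{\lambda : h(\lambda)\text{ is positive definite}\}$ and $\Lambda_1=\{\lambda\in\Lambda : \lambda>0,\ \|\lambda\|_1=1\}$. For $\lambda\in\Lambda$ let $\varphi(\lambda)=\tfrac12h(\lambda)^{-1}[\lambda]\mathcal I_L^*$, $\|x\|_{h(\lambda)}=\sqrt{x^{\mathsf T}h(\lambda)x}$, and $H_\lambda=\{y\in\mathbb R^n : \lambda^{\mathsf T}y\le\|\varphi(\lambda)\|_{h(\lambda)}^2\}$. Theorem. The set $\mathcal F$ is closed and convex, and $$\mathcal F=P_c(\operatorname{cl}\mathcal D)=\operatorname{cl}(\operatorname{conv}\mathcal F)=\bigcap_{\lambda\in\Lambda_1}H_\lambda=\operatorname{im}P_c,$$ where $\operatorname{im}P_c=\{P_c(x) : x\in\mathbb R^n\}$.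 -/

import Mathlib

open Matrix

noncomputable section

/-- A DC power grid at steady state: a connected resistive network whose nodes are
the loads `L` and the sources `S`. Lines are the edges of `graph`, and the line between
`i` and `j` has the positive conductance `w i j = w j i` (values of `w` at pairs that are
not joined by a line are never used). -/
structure DCGrid (L S : Type*) where
  graph : SimpleGraph (L ⊕ S)
  w : L ⊕ S → L ⊕ S → ℝ
  w_symm : ∀ i j, graph.Adj i j → w i j = w j i
  w_pos : ∀ i j, graph.Adj i j → 0 < w i j
  connected : graph.Connected

namespace DCGrid

variable {L S : Type*} [Fintype L] [Fintype S] [DecidableEq L] [DecidableEq S]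

/-- The graph formed by the loads and the lines between loads. -/
def loadGraph {L S : Type*} (G : DCGrid L S) : SimpleGraph L :=
  G.graph.comap Sum.inl

open Classical in
/-- The Kirchhoff matrix `Y` of the grid. -/
def Y (G : DCGrid L S) : Matrix (L ⊕ S) (L ⊕ S) ℝ :=
  Matrix.of fun i j =>
    if i = j then ∑ k, if G.graph.Adj k i then G.w i k else 0
    else if G.graph.Adj i j then -G.w i j
    else 0

/-- The load-load block `Y_LL`. -/
def YLL (G : DCGrid L S) : Matrix L L ℝ := G.Y.toBlocks₁₁

/-- The load-source block `Y_LS`. -/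
def YLS (G : DCGrid L S) : Matrix L S ℝ := G.Y.toBlocks₁₂

/-- The source-injected currents `I_L^* = -Y_LS V_S`. -/
def sourceCurrents (G : DCGrid L S) (VS : S → ℝ) : L → ℝ :=
  -(G.YLS *ᵥ VS)

/-- The open-circuit voltages `V_L^* = Y_LL⁻¹ I_L^*`. -/
def openCircuitVoltages (G : DCGrid L S) (VS : S → ℝ) : L → ℝ :=
  G.YLL⁻¹ *ᵥ G.sourceCurrents VS

/-- `V` is an operating point associated to the power demands `p`: it is a positive vector
that satisfies the power flow equation `[V] Y_LL (V - V_L^*) + p = 0`. -/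
def IsOperatingPoint (G : DCGrid L S) (VS : S → ℝ) (V p : L → ℝ) : Prop :=
  (∀ i, 0 < V i) ∧
    (diagonal V * G.YLL) *ᵥ (V - G.openCircuitVoltages VS) + p = 0

/-- The set `F` of feasible power demands. -/
def feasible (G : DCGrid L S) (VS : S → ℝ) : Set (L → ℝ) :=
  {p | ∃ V, G.IsOperatingPoint VS V p}

/-- The map `P_c(V) = [V] Y_LL (V_L^* - V)`, on all of `ℝⁿ`. -/
def Pc (G : DCGrid L S) (VS : S → ℝ) (V : L → ℝ) : L → ℝ :=
  (diagonal V * G.YLL) *ᵥ (G.openCircuitVoltages VS - V)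

/-- The Jacobian matrix of `P_c` at `V`. -/
def jacobian (G : DCGrid L S) (VS : S → ℝ) (V : L → ℝ) : Matrix L L ℝ :=
  LinearMap.toMatrix' (fderiv ℝ (G.Pc VS) V).toLinearMap

/-- `V` is a long-term voltage stable operating point associated to `p`: the Jacobian of `P_c`
at `V` is nonsingular and all elements of its inverse are negative. -/
def IsLongTermVoltageStable (G : DCGrid L S) (VS : S → ℝ) (V p : L → ℝ) : Prop :=
  G.IsOperatingPoint VS V p ∧ IsUnit (G.jacobian VS V) ∧
    ∀ i j, (G.jacobian VS V)⁻¹ i j < 0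

/-- The set `D` of long-term voltage stable operating points. -/
def stablePoints (G : DCGrid L S) (VS : S → ℝ) : Set (L → ℝ) :=
  {V | ∃ p, G.IsLongTermVoltageStable VS V p}

/-- `h(l) = ½ ([l] Y_LL + Y_LL [l])`. -/
def h (G : DCGrid L S) (l : L → ℝ) : Matrix L L ℝ :=
  (1 / 2 : ℝ) • (diagonal l * G.YLL + G.YLL * diagonal l)

/-- `Λ`, the set of `l` for which `h(l)` is positive definite. -/
def Lam (G : DCGrid L S) : Set (L → ℝ) :=
  {l | (G.h l).PosDef}

/-- `Λ₁`, the set of positive vectors in `Λ` whose 1-norm equals one. -/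
def Lam₁ (G : DCGrid L S) : Set (L → ℝ) :=
  G.Lam ∩ {l | (∀ i, 0 < l i) ∧ ∑ i, |l i| = 1}

/-- `φ(l) = ½ h(l)⁻¹ [l] I_L^*`. -/
def phi (G : DCGrid L S) (VS : S → ℝ) (l : L → ℝ) : L → ℝ :=
  (1 / 2 : ℝ) • (((G.h l)⁻¹ * diagonal l) *ᵥ G.sourceCurrents VS)

/-- The vector norm `‖x‖_{h(l)} = √(xᵀ h(l) x)` induced by `h(l)`, for `l ∈ Λ`. -/
def hNorm (G : DCGrid L S) (l x : L → ℝ) : ℝ :=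
  Real.sqrt (x ⬝ᵥ (G.h l *ᵥ x))

/-- The half-space `H_l = {y : lᵀ y ≤ ‖φ(l)‖²_{h(l)}}`. -/
def halfSpace (G : DCGrid L S) (VS : S → ℝ) (l : L → ℝ) : Set (L → ℝ) :=
  {y | l ⬝ᵥ y ≤ G.hNorm l (G.phi VS l) ^ 2}

end DCGrid

end

/-! The equalities follow from a cycle of inclusions: the feasible set lies in the range of `Pc`,
the range in the intersection of half-spaces, the intersection in the image of the closed stable
set, and that image in the feasible set. Closedness and convexity are then inherited from the
half-spaces.

Completing the square in the weighted power `l ⬝ᵥ Pc x` gives the second inclusion. The third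
carries the weight. The demands dominated by the power at some nonnegative voltage form the set
`hypograph`. It is convex because the power is concave in the squared voltages, and closed because
superlevel sets are compact. A demand outside it is separated from it by a weight under which power
is bounded above; `posDef_weighted_of_bddAbove` shows that such a weight, once normalized, lies in
`Lam₁`, so the demand violates one of the half-spaces.

For a demand in `hypograph`, the superlevel set is compact and stable under suprema, hence has a
greatest element, at which the demand is met exactly. Lowering the demand slightly makes the
greatest element stable: the gradient inequality supplies a nonnegative vector that the negated
Jacobian maps to a positive one, so this irreducible Z-matrix has a positive inverse. Letting the
slack tend to zero reaches the original greatest element.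

For the last inclusion, a zero voltage in the closed stable set would spread along the connected
load graph and contradict the nonzero source currents. -/

namespace LoadFlow

/-- A symmetric positive definite matrix with nonpositive off-diagonal elements, whose
off-diagonal pattern contains a connected graph `H`. -/
structure IsIrreducibleStieltjes {L : Type*} (H : SimpleGraph L) (A : Matrix L L ℝ) : Prop where
  connected : H.Connected
  isSymm : A.IsSymm
  offDiag : ∀ i j, i ≠ j → A i j ≤ 0
  adj : ∀ i j, H.Adj i j → A i j < 0
  posDef : A.PosDef

/-- The power map `x ↦ [x] (b - A x)`. -/
def powerMap {L : Type*} [Fintype L] (A : Matrix L L ℝ) (b x : L → ℝ) : L → ℝ :=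
  fun i => x i * (b i - (A *ᵥ x) i)

theorem continuous_powerMap {L : Type*} [Fintype L] (A : Matrix L L ℝ) (b : L → ℝ) :
    Continuous (powerMap A b) := by
  unfold powerMap
  fun_prop

theorem forall_of_connected {L : Type*} {H : SimpleGraph L} (hH : H.Connected) {p : L → Prop}
    (hp : ∀ i j, H.Adj i j → p i → p j) {i : L} (hi : p i) (j : L) : p j := by
  obtain ⟨w⟩ := hH.preconnected i j
  induction w with
  | nil => exact hi
  | cons hadj _ ih => exact ih (hp _ _ hadj hi)

section

variable {L : Type*} [Fintype L] [DecidableEq L]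

theorem mulVec_eq_diag_add (A : Matrix L L ℝ) (x : L → ℝ) (i : L) :
    (A *ᵥ x) i = A i i * x i + ∑ j ∈ Finset.univ.erase i, A i j * x j :=
  (Finset.add_sum_erase _ _ (Finset.mem_univ i)).symm

theorem offDiag_sum_nonpos {A : Matrix L L ℝ} (hA : ∀ i j, i ≠ j → A i j ≤ 0) {x : L → ℝ}
    (hx : 0 ≤ x) (i : L) : ∑ j ∈ Finset.univ.erase i, A i j * x j ≤ 0 :=
  Finset.sum_nonpos fun j hj =>
    mul_nonpos_of_nonpos_of_nonneg (hA i j (Finset.ne_of_mem_erase hj).symm) (hx j)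

/-- If a nonnegative vector vanishes at a node where the off-diagonal row sum does not pull below
zero, then it vanishes at the neighbours. -/
theorem eq_zero_of_adj {H : SimpleGraph L} {A : Matrix L L ℝ} (hA : ∀ i j, i ≠ j → A i j ≤ 0)
    (hadj : ∀ i j, H.Adj i j → A i j < 0) {x : L → ℝ} (hx : 0 ≤ x) {i j : L} (hij : H.Adj i j)
    (hi : 0 ≤ ∑ k ∈ Finset.univ.erase i, A i k * x k) : x j = 0 := by
  have h1 : ∑ k ∈ Finset.univ.erase i, A i k * x k = 0 :=
    le_antisymm (offDiag_sum_nonpos hA hx i) hi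
  have h2 := (Finset.sum_eq_zero_iff_of_nonpos fun k hk =>
    mul_nonpos_of_nonpos_of_nonneg (hA i k (Finset.ne_of_mem_erase hk).symm) (hx k)).1 h1 j
      (Finset.mem_erase.2 ⟨hij.ne', Finset.mem_univ j⟩)
  exact (mul_eq_zero.1 h2).resolve_left (hadj i j hij).ne

/-! ### Z-matrices with a positive certificate -/

section ZMatrix

variable {M : Matrix L L ℝ} {u : L → ℝ}

theorem pos_of_mulVec_pos (hM : ∀ i j, i ≠ j → M i j ≤ 0) (hu : 0 ≤ u)
    (hMu : ∀ i, 0 < (M *ᵥ u) i) (i : L) : 0 < u i := by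
  refine (hu i).lt_of_ne fun h => ?_
  have h1 := hMu i
  rw [mulVec_eq_diag_add, ← h, Pi.zero_apply, mul_zero, zero_add] at h1
  exact (offDiag_sum_nonpos hM hu i).not_gt h1

/-- Were `x` negative somewhere, the row `i` minimizing `x i / u i` would have a ratio `r < 0` with
`x ≥ r • u` and equality at `i`; the signs off the diagonal then force `(M *ᵥ x) i ≤ r * (M *ᵥ u) i
< 0`. -/
theorem nonneg_of_mulVec_nonneg (hM : ∀ i j, i ≠ j → M i j ≤ 0) (hu : 0 ≤ u)
    (hMu : ∀ i, 0 < (M *ᵥ u) i) {x : L → ℝ} (hx : 0 ≤ M *ᵥ x) : 0 ≤ x := by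
  have hpos := pos_of_mulVec_pos hM hu hMu
  by_contra hneg
  obtain ⟨k, hk⟩ : ∃ k, x k < 0 := by simpa [Pi.le_def] using hneg
  have : Nonempty L := ⟨k⟩
  obtain ⟨i, hi⟩ := Finite.exists_min fun i => x i / u i
  have hr : x i / u i < 0 := (hi k).trans_lt (div_neg_of_neg_of_pos hk (hpos k))
  have h1 : (M *ᵥ x) i ≤ x i / u i * (M *ᵥ u) i := by
    simp only [mulVec, dotProduct, Finset.mul_sum]
    refine Finset.sum_le_sum fun j _ => ?_
    by_cases hij : i = j
    · subst hij
      apply le_of_eq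
      have := (hpos i).ne'
      field_simp
    · have h2 : x i / u i * u j ≤ x j := (le_div_iff₀ (hpos j)).1 (hi j)
      nlinarith [mul_le_mul_of_nonpos_left h2 (hM i j hij)]
  have h3 := mul_neg_of_neg_of_pos hr (hMu i)
  have := hx i
  simp only [Pi.zero_apply] at this
  linarith

theorem isUnit_of_mulVec_pos (hM : ∀ i j, i ≠ j → M i j ≤ 0) (hu : 0 ≤ u)
    (hMu : ∀ i, 0 < (M *ᵥ u) i) : IsUnit M := by
  rw [← mulVec_injective_iff_isUnit]
  intro x y hxy
  have hxy' : M *ᵥ x = M *ᵥ y := hxy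
  have h1 : M *ᵥ (x - y) = 0 := by rw [mulVec_sub, hxy', sub_self]
  have h2 : M *ᵥ (y - x) = 0 := by rw [mulVec_sub, hxy', sub_self]
  exact le_antisymm (sub_nonneg.1 (nonneg_of_mulVec_nonneg hM hu hMu h2.ge))
    (sub_nonneg.1 (nonneg_of_mulVec_nonneg hM hu hMu h1.ge))

/-- Columns of the inverse are nonnegative. A zero in one spreads along the edges of `H` until the
whole column vanishes, which its image `Pi.single j 1` excludes. -/
theorem inv_pos_of_mulVec_pos {H : SimpleGraph L} (hH : H.Connected)
    (hadj : ∀ i j, H.Adj i j → M i j < 0) (hM : ∀ i j, i ≠ j → M i j ≤ 0) (hu : 0 ≤ u)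
    (hMu : ∀ i, 0 < (M *ᵥ u) i) (i j : L) : 0 < M⁻¹ i j := by
  have hdet := (isUnit_iff_isUnit_det M).1 (isUnit_of_mulVec_pos hM hu hMu)
  have hcol : M *ᵥ (fun k => M⁻¹ k j) = Pi.single j 1 := by
    have : (fun k => M⁻¹ k j) = M⁻¹ *ᵥ Pi.single j 1 := by ext k; simp
    rw [this, mulVec_mulVec, mul_nonsing_inv _ hdet, one_mulVec]
  have hnn : 0 ≤ M *ᵥ (fun k => M⁻¹ k j) := by
    rw [hcol]; exact Pi.single_nonneg.2 zero_le_one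
  have hx := nonneg_of_mulVec_nonneg hM hu hMu hnn
  refine (hx i).lt_of_ne fun hi => ?_
  have hall : ∀ k, M⁻¹ k j = 0 := by
    refine forall_of_connected hH (p := fun k => M⁻¹ k j = 0) (fun k l hkl hk => ?_) hi.symm
    refine eq_zero_of_adj (x := fun k => M⁻¹ k j) hM hadj hx hkl ?_
    have := hnn k
    rw [mulVec_eq_diag_add] at this
    simpa [hk] using this
  have h0 : (fun k => M⁻¹ k j) = 0 := funext hall
  rw [h0, mulVec_zero] at hcol
  simpa using congrFun hcol j

theorem diag_pos_of_inv_nonneg (hM : ∀ i j, i ≠ j → M i j ≤ 0) (hunit : IsUnit M)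
    (hinv : ∀ i j, 0 ≤ M⁻¹ i j) (i : L) : 0 < M i i := by
  have hdet := (isUnit_iff_isUnit_det M).1 hunit
  have h1 : (M * M⁻¹) i i = 1 := by rw [mul_nonsing_inv _ hdet, one_apply_eq]
  rw [mul_apply, ← Finset.add_sum_erase _ _ (Finset.mem_univ i)] at h1
  have h2 := offDiag_sum_nonpos hM (x := fun k => M⁻¹ k i) (fun k => hinv k i) i
  by_contra hneg
  have := mul_nonpos_of_nonpos_of_nonneg (not_lt.1 hneg) (hinv i i)
  linarith

end ZMatrix

/-! ### The power map -/

section PowerMap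

variable {A : Matrix L L ℝ} {b : L → ℝ}

theorem powerMap_eq (A : Matrix L L ℝ) (b x : L → ℝ) (i : L) :
    powerMap A b x i = b i * x i - A i i * x i ^ 2
      + ∑ j ∈ Finset.univ.erase i, -A i j * (x i * x j) := by
  have : ∑ j ∈ Finset.univ.erase i, -A i j * (x i * x j)
      = -(x i * ∑ j ∈ Finset.univ.erase i, A i j * x j) := by
    rw [Finset.mul_sum, ← Finset.sum_neg_distrib]
    exact Finset.sum_congr rfl fun j _ => by ring
  rw [this, powerMap, mulVec_eq_diag_add]
  ring

/-- With the own voltage fixed, raising the other voltages can only raise the power at a node. This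
makes superlevel sets stable under suprema. -/
theorem powerMap_le_of_eq (hA : ∀ i j, i ≠ j → A i j ≤ 0) {x y : L → ℝ} (hx : 0 ≤ x)
    (hxy : x ≤ y) {i : L} (hi : x i = y i) : powerMap A b x i ≤ powerMap A b y i := by
  rw [powerMap_eq, powerMap_eq, hi]
  gcongr with j hj
  · exact neg_nonneg.2 (hA i j (Finset.ne_of_mem_erase hj).symm)
  · exact (hx i).trans (hxy i)
  · exact hxy j

theorem sup_mem_superlevel (hA : ∀ i j, i ≠ j → A i j ≤ 0) {q x y : L → ℝ} (hx : 0 ≤ x)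
    (hy : 0 ≤ y) (hqx : q ≤ powerMap A b x) (hqy : q ≤ powerMap A b y) :
    q ≤ powerMap A b (x ⊔ y) := by
  intro i
  rcases le_total (x i) (y i) with h | h
  · exact (hqy i).trans (powerMap_le_of_eq hA hy le_sup_right (by simp [h]))
  · exact (hqx i).trans (powerMap_le_of_eq hA hx le_sup_left (by simp [h]))

/-- Along `√(s x² + t y²)` the power map dominates the convex combination of its values:
it is a concave function of the squared voltages. -/
theorem combo_le_powerMap_sqrt (hA : ∀ i j, i ≠ j → A i j ≤ 0) (hb : 0 ≤ b) (x y : L → ℝ)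
    {s t : ℝ} (hs : 0 ≤ s) (ht : 0 ≤ t) (hst : s + t = 1) :
    s • powerMap A b x + t • powerMap A b y
      ≤ powerMap A b fun i => √(s * x i ^ 2 + t * y i ^ 2) := by
  have hz : ∀ i, 0 ≤ s * x i ^ 2 + t * y i ^ 2 := fun i => by positivity
  -- Cauchy–Schwarz for the vectors `(√s x i, √t y i)` and `(√s x j, √t y j)`.
  have h2 : ∀ i j, s * (x i * x j) + t * (y i * y j)
      ≤ √(s * x i ^ 2 + t * y i ^ 2) * √(s * x j ^ 2 + t * y j ^ 2) := fun i j => by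
    rw [← Real.sqrt_mul (hz i)]
    apply Real.le_sqrt_of_sq_le
    nlinarith [mul_nonneg (mul_nonneg hs ht) (sq_nonneg (x i * y j - x j * y i))]
  have h1 : ∀ i, s * x i + t * y i ≤ √(s * x i ^ 2 + t * y i ^ 2) := fun i => by
    apply Real.le_sqrt_of_sq_le
    have ht' : t = 1 - s := by linarith
    subst ht'
    nlinarith [mul_nonneg (mul_nonneg hs ht) (sq_nonneg (x i - y i))]
  intro i
  have hsum : s * ∑ j ∈ Finset.univ.erase i, -A i j * (x i * x j)
      + t * ∑ j ∈ Finset.univ.erase i, -A i j * (y i * y j)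
      ≤ ∑ j ∈ Finset.univ.erase i, -A i j *
        (√(s * x i ^ 2 + t * y i ^ 2) * √(s * x j ^ 2 + t * y j ^ 2)) := by
    rw [Finset.mul_sum, Finset.mul_sum, ← Finset.sum_add_distrib]
    refine Finset.sum_le_sum fun j hj => ?_
    have := mul_le_mul_of_nonneg_left (h2 i j)
      (neg_nonneg.2 (hA i j (Finset.ne_of_mem_erase hj).symm))
    linarith
  have hlin := mul_le_mul_of_nonneg_left (h1 i) (hb i)
  simp only [Pi.add_apply, Pi.smul_apply, smul_eq_mul, powerMap_eq]
  rw [Real.sq_sqrt (hz i)]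
  linarith

/-- The elements of the Jacobian matrix of the power map. -/
def powerJacobian (A : Matrix L L ℝ) (b x : L → ℝ) : Matrix L L ℝ :=
  diagonal (b - A *ᵥ x) - diagonal x * A

theorem powerJacobian_apply_ne {x : L → ℝ} {i j : L} (hij : i ≠ j) :
    powerJacobian A b x i j = -(x i * A i j) := by
  simp [powerJacobian, hij]

theorem powerJacobian_apply_self (A : Matrix L L ℝ) (b x : L → ℝ) (i : L) :
    powerJacobian A b x i i
      = b i - 2 * (A i i * x i) - ∑ j ∈ Finset.univ.erase i, A i j * x j := by
  simp only [powerJacobian, Matrix.sub_apply, diagonal_apply_eq, Pi.sub_apply, diagonal_mul,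
    mulVec_eq_diag_add]
  ring

/-- The gradient inequality of the power map, as a concave function of squared voltages. -/
theorem powerMap_sub_le (hA : ∀ i j, i ≠ j → A i j ≤ 0) (hb : 0 ≤ b) {v w : L → ℝ}
    (hw : ∀ i, 0 < w i) :
    powerMap A b v - powerMap A b w
      ≤ powerJacobian A b w *ᵥ fun i => (v i ^ 2 - w i ^ 2) / (2 * w i) := by
  intro i
  rw [Pi.sub_apply, powerMap_eq, powerMap_eq, mulVec_eq_diag_add, powerJacobian_apply_self]
  have hsum : ∑ j ∈ Finset.univ.erase i, -A i j * (v i * v j)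
      ≤ ∑ j ∈ Finset.univ.erase i, (-A i j * (w i * w j)
        + (-A i j * w j) * ((v i ^ 2 - w i ^ 2) / (2 * w i))
        + powerJacobian A b w i j * ((v j ^ 2 - w j ^ 2) / (2 * w j))) := by
    refine Finset.sum_le_sum fun j hj => ?_
    have hij := (Finset.ne_of_mem_erase hj).symm
    rw [powerJacobian_apply_ne hij]
    have hwi := hw i
    have hwj := hw j
    -- The tangent plane of the concave function `√(a c)` of the squared voltages, taken at `(w i ^
    -- 2, w j ^ 2)`; the gap is a perfect square over a positive number.
    have key : v i * v j ≤ w i * w j + w j * ((v i ^ 2 - w i ^ 2) / (2 * w i))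
        + w i * ((v j ^ 2 - w j ^ 2) / (2 * w j)) := by
      have : w i * w j + w j * ((v i ^ 2 - w i ^ 2) / (2 * w i))
          + w i * ((v j ^ 2 - w j ^ 2) / (2 * w j)) - v i * v j
          = (w j * v i - w i * v j) ^ 2 / (2 * w i * w j) := by
        field_simp
        ring
      have h0 : 0 ≤ (w j * v i - w i * v j) ^ 2 / (2 * w i * w j) := by positivity
      linarith
    have := mul_le_mul_of_nonneg_left key (neg_nonneg.2 (hA i j hij))
    linarith
  rw [Finset.sum_add_distrib, Finset.sum_add_distrib, ← Finset.sum_mul] at hsum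
  have hneg : ∑ j ∈ Finset.univ.erase i, -A i j * w j
      = -∑ j ∈ Finset.univ.erase i, A i j * w j := by
    rw [← Finset.sum_neg_distrib]
    exact Finset.sum_congr rfl fun j _ => by ring
  rw [hneg] at hsum
  have hwi := hw i
  have hlin : b i * (v i - w i) ≤ b i * ((v i ^ 2 - w i ^ 2) / (2 * w i)) := by
    refine mul_le_mul_of_nonneg_left ?_ (hb i)
    rw [le_div_iff₀ (by positivity)]
    nlinarith [sq_nonneg (v i - w i)]
  have hquad : 2 * (A i i * w i) * ((v i ^ 2 - w i ^ 2) / (2 * w i))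
      = A i i * (v i ^ 2 - w i ^ 2) := by
    field_simp
  linarith

theorem hasFDerivAt_powerMap (A : Matrix L L ℝ) (b x : L → ℝ) :
    HasFDerivAt (powerMap A b) (powerJacobian A b x).mulVecLin.toContinuousLinearMap x := by
  rw [hasFDerivAt_pi']
  intro i
  have h1 : HasFDerivAt (fun y : L → ℝ => y i)
      (ContinuousLinearMap.proj (R := ℝ) (φ := fun _ : L => ℝ) i) x := hasFDerivAt_apply i x
  have h2 : HasFDerivAt (fun y : L → ℝ => b i - (A *ᵥ y) i)
      (-((ContinuousLinearMap.proj (R := ℝ) (φ := fun _ : L => ℝ) i).comp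
        A.mulVecLin.toContinuousLinearMap)) x :=
    ((ContinuousLinearMap.proj (R := ℝ) (φ := fun _ : L => ℝ) i).comp
        A.mulVecLin.toContinuousLinearMap).hasFDerivAt.const_sub (b i)
  refine (h1.mul h2).congr_fderiv ?_
  ext y
  have h3 : ((diagonal x * A) *ᵥ y) i = x i * (A *ᵥ y) i := by
    rw [← mulVec_mulVec, mulVec_diagonal]
  simp [powerJacobian, mulVec_diagonal, h3]
  ring

end PowerMap

end

end LoadFlow

/-! ### Weighted powers and their quadratic forms -/

namespace LoadFlow

section Weighted

variable {L : Type*} [Fintype L] [DecidableEq L]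

/-- The symmetrized weighted matrix `½ ([l] A + A [l])`. -/
noncomputable def weighted (A : Matrix L L ℝ) (l : L → ℝ) : Matrix L L ℝ :=
  (1 / 2 : ℝ) • (diagonal l * A + A * diagonal l)

theorem weighted_apply (A : Matrix L L ℝ) (l : L → ℝ) (i j : L) :
    weighted A l i j = (l i + l j) / 2 * A i j := by
  simp [weighted]
  ring

theorem weighted_isSymm {A : Matrix L L ℝ} (hA : A.IsSymm) (l : L → ℝ) :
    (weighted A l).IsSymm := by
  ext i j
  rw [transpose_apply, weighted_apply, weighted_apply, hA.apply, add_comm]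

theorem dotProduct_weighted_mulVec {A : Matrix L L ℝ} (hA : A.IsSymm) (l x : L → ℝ) :
    x ⬝ᵥ (weighted A l *ᵥ x) = ∑ i, l i * (x i * (A *ᵥ x) i) := by
  have h1 : x ⬝ᵥ ((diagonal l * A) *ᵥ x) = ∑ i, l i * (x i * (A *ᵥ x) i) := by
    rw [← mulVec_mulVec]
    simp only [dotProduct, mulVec_diagonal]
    exact Finset.sum_congr rfl fun i _ => by ring
  have h2 : x ⬝ᵥ ((A * diagonal l) *ᵥ x) = x ⬝ᵥ ((diagonal l * A) *ᵥ x) := by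
    have : A * diagonal l = (diagonal l * A)ᵀ := by rw [transpose_mul, hA.eq, diagonal_transpose]
    rw [this, dotProduct_mulVec, vecMul_transpose, dotProduct_comm]
  rw [weighted, smul_mulVec, dotProduct_smul, add_mulVec, dotProduct_add, h2, h1, smul_eq_mul]
  ring

theorem dotProduct_powerMap {A : Matrix L L ℝ} (hA : A.IsSymm) (b l x : L → ℝ) :
    l ⬝ᵥ powerMap A b x = ∑ i, l i * b i * x i - x ⬝ᵥ (weighted A l *ᵥ x) := by
  rw [dotProduct_weighted_mulVec hA, ← Finset.sum_sub_distrib]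
  exact Finset.sum_congr rfl fun i _ => by rw [powerMap]; ring

theorem abs_dotProduct_mulVec_abs_le {M : Matrix L L ℝ} (hM : ∀ i j, i ≠ j → M i j ≤ 0)
    (x : L → ℝ) : |x| ⬝ᵥ (M *ᵥ |x|) ≤ x ⬝ᵥ (M *ᵥ x) := by
  simp only [dotProduct, mulVec, Finset.mul_sum]
  refine Finset.sum_le_sum fun i _ => Finset.sum_le_sum fun j _ => ?_
  simp only [Pi.abs_apply]
  by_cases hij : i = j
  · subst hij
    have := abs_mul_abs_self (x i)
    apply le_of_eq
    linear_combination M i i * this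
  · have h1 : x i * x j ≤ |x i| * |x j| := by rw [← abs_mul]; exact le_abs_self _
    have := mul_le_mul_of_nonpos_left h1 (hM i j hij)
    linarith

theorem weighted_offDiag_nonpos {A : Matrix L L ℝ} (hA : ∀ i j, i ≠ j → A i j ≤ 0) {l : L → ℝ}
    (hl : 0 ≤ l) (i j : L) (hij : i ≠ j) : weighted A l i j ≤ 0 := by
  rw [weighted_apply]
  have h1 : 0 ≤ l i := hl i
  have h2 : 0 ≤ l j := hl j
  exact mul_nonpos_of_nonneg_of_nonpos (by positivity) (hA i j hij)

/-- Separation only controls nonnegative voltages; this transfers its bound to arbitrary ones. -/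
theorem dotProduct_powerMap_le_abs {A : Matrix L L ℝ} (hsymm : A.IsSymm)
    (hA : ∀ i j, i ≠ j → A i j ≤ 0) {b l : L → ℝ} (hb : 0 ≤ b) (hl : 0 ≤ l) (x : L → ℝ) :
    l ⬝ᵥ powerMap A b x ≤ l ⬝ᵥ powerMap A b |x| := by
  rw [dotProduct_powerMap hsymm, dotProduct_powerMap hsymm]
  have h1 := abs_dotProduct_mulVec_abs_le (weighted_offDiag_nonpos hA hl) x
  have h2 : ∑ i, l i * b i * x i ≤ ∑ i, l i * b i * |x| i :=
    Finset.sum_le_sum fun i _ =>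
      mul_le_mul_of_nonneg_left (le_abs_self _) (mul_nonneg (hl i) (hb i))
  linarith

end Weighted

/-! ### Compact superlevel sets and their greatest elements -/

theorem exists_coercive {L : Type*} [Fintype L] [Nonempty L] {A : Matrix L L ℝ}
    (hA : A.PosDef) : ∃ m > 0, ∀ x : L → ℝ, m * ‖x‖ ^ 2 ≤ x ⬝ᵥ (A *ᵥ x) := by
  have hne : (Metric.sphere (0 : L → ℝ) 1).Nonempty := NormedSpace.sphere_nonempty.2 zero_le_one
  have hcont : Continuous fun x : L → ℝ => x ⬝ᵥ (A *ᵥ x) := by fun_prop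
  obtain ⟨z, hz, hmin⟩ := (isCompact_sphere (0 : L → ℝ) 1).exists_isMinOn hne hcont.continuousOn
  have hz1 : ‖z‖ = 1 := mem_sphere_zero_iff_norm.1 hz
  refine ⟨z ⬝ᵥ (A *ᵥ z), ?_, fun x => ?_⟩
  · have hz0 : z ≠ 0 := by
      rintro rfl
      simp at hz1
    simpa using hA.dotProduct_mulVec_pos hz0
  · by_cases hx : x = 0
    · simp [hx]
    have hpos : 0 < ‖x‖ := norm_pos_iff.2 hx
    have hmem : ‖x‖⁻¹ • x ∈ Metric.sphere (0 : L → ℝ) 1 := by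
      rw [mem_sphere_zero_iff_norm, norm_smul, norm_inv, norm_norm, inv_mul_cancel₀ hpos.ne']
    have h1 : z ⬝ᵥ (A *ᵥ z) ≤ (‖x‖⁻¹ • x) ⬝ᵥ (A *ᵥ (‖x‖⁻¹ • x)) := hmin hmem
    rw [mulVec_smul, smul_dotProduct, dotProduct_smul, smul_eq_mul, smul_eq_mul] at h1
    calc _ ≤ ‖x‖⁻¹ * (‖x‖⁻¹ * x ⬝ᵥ (A *ᵥ x)) * ‖x‖ ^ 2 := by gcongr
      _ = _ := by field_simp

/-- The nonnegative voltages whose power is at least `q`. -/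
def superlevel {L : Type*} [Fintype L] (A : Matrix L L ℝ) (b q : L → ℝ) : Set (L → ℝ) :=
  {x | 0 ≤ x ∧ q ≤ powerMap A b x}

/-- Summing the demand inequalities over the nodes bounds `x ⬝ᵥ (A *ᵥ x)` by an affine function of
`‖x‖`, while coercivity makes it grow quadratically. -/
theorem isCompact_superlevel {L : Type*} [Fintype L] {H : SimpleGraph L} {A : Matrix L L ℝ}
    {b : L → ℝ} (hA : IsIrreducibleStieltjes H A) (hb : 0 ≤ b) (q : L → ℝ) :
    IsCompact (superlevel A b q) := by
  have : Nonempty L := hA.connected.nonempty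
  refine Metric.isCompact_of_isClosed_isBounded ?_ ?_
  · exact (isClosed_le continuous_const continuous_id).inter
      (isClosed_le continuous_const (continuous_powerMap A b))
  obtain ⟨m, hm, hcoer⟩ := exists_coercive hA.posDef
  set B := ∑ i, b i
  set C := |∑ i, q i|
  have hB : 0 ≤ B := Finset.sum_nonneg fun i _ => hb i
  refine isBounded_iff_forall_norm_le.2 ⟨1 + (B + C) / m, ?_⟩
  rintro x ⟨hx, hq⟩
  have h1 : ∑ i, q i ≤ ∑ i, b i * x i - x ⬝ᵥ (A *ᵥ x) := by
    rw [dotProduct, ← Finset.sum_sub_distrib]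
    refine Finset.sum_le_sum fun i _ => (hq i).trans_eq ?_
    rw [powerMap]
    ring
  have h2 : ∑ i, b i * x i ≤ B * ‖x‖ := by
    rw [Finset.sum_mul]
    exact Finset.sum_le_sum fun i _ =>
      mul_le_mul_of_nonneg_left ((le_abs_self _).trans (norm_le_pi_norm x i)) (hb i)
  have h3 := hcoer x
  have h4 : -C ≤ ∑ i, q i := neg_abs_le _
  have hC : 0 ≤ C := abs_nonneg _
  rcases le_total ‖x‖ 1 with h | h
  · have : 0 ≤ (B + C) / m := by positivity
    linarith
  · have h5 : ‖x‖ ≤ (B + C) / m := by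
      rw [le_div_iff₀ hm]
      have h6 : m * ‖x‖ ^ 2 ≤ (B + C) * ‖x‖ := by nlinarith
      have h7 : 0 < ‖x‖ := by linarith
      refine le_of_mul_le_mul_right ?_ h7
      linarith
    linarith

section Superlevel

variable {L : Type*} [Fintype L] [DecidableEq L] {H : SimpleGraph L} {A : Matrix L L ℝ}
  {b : L → ℝ}

/-- A maximizer of the coordinate sum is greatest, since joining it with any other element stays in
the set and cannot increase the sum. -/
theorem exists_isGreatest_superlevel (hA : IsIrreducibleStieltjes H A) (hb : 0 ≤ b)
    {q : L → ℝ} (hq : (superlevel A b q).Nonempty) : ∃ v, IsGreatest (superlevel A b q) v := by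
  have hcont : Continuous fun x : L → ℝ => ∑ i, x i := by fun_prop
  obtain ⟨v, hv, hmax⟩ := (isCompact_superlevel hA hb q).exists_isMaxOn hq hcont.continuousOn
  refine ⟨v, hv, fun x hx => ?_⟩
  have hsup : v ⊔ x ∈ superlevel A b q :=
    ⟨hv.1.trans le_sup_left, sup_mem_superlevel hA.offDiag hv.1 hx.1 hv.2 hx.2⟩
  have h1 : ∑ i, (v ⊔ x) i ≤ ∑ i, v i := hmax hsup
  have hle : ∀ i ∈ Finset.univ, v i ≤ (v ⊔ x) i := fun i _ => le_sup_left (a := v) (b := x) i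
  have h2 := (Finset.sum_eq_sum_iff_of_le hle).1 (le_antisymm (Finset.sum_le_sum hle) h1)
  exact fun i => (le_sup_right (a := v) (b := x) i).trans (h2 i (Finset.mem_univ i)).ge

/-- A nonnegative vector is positive if at its zeros nothing is injected, neither from outside nor
by neighbours, unless there is no injection at all. -/
theorem pos_of_zero_imp (hA : IsIrreducibleStieltjes H A) (hb : 0 ≤ b) (hb0 : b ≠ 0)
    {v : L → ℝ} (hv : 0 ≤ v)
    (hz : ∀ i, v i = 0 → b i ≤ ∑ j ∈ Finset.univ.erase i, A i j * v j) (i : L) : 0 < v i := by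
  refine (hv i).lt_of_ne fun hi => hb0 ?_
  have hall : ∀ k, v k = 0 :=
    forall_of_connected hA.connected (p := fun k => v k = 0) (fun k l hkl hk =>
      eq_zero_of_adj hA.offDiag hA.adj hv hkl ((hb k).trans (hz k hk))) hi.symm
  ext k
  exact le_antisymm ((hz k (hall k)).trans (offDiag_sum_nonpos hA.offDiag hv k)) (hb k)

theorem powerMap_update (A : Matrix L L ℝ) (b v : L → ℝ) (i : L) (t : ℝ) :
    powerMap A b (Function.update v i t) i
      = t * (b i - A i i * t - ∑ j ∈ Finset.univ.erase i, A i j * v j) := by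
  rw [powerMap, mulVec_eq_diag_add, Function.update_self]
  have : ∑ j ∈ Finset.univ.erase i, A i j * Function.update v i t j
      = ∑ j ∈ Finset.univ.erase i, A i j * v j :=
    Finset.sum_congr rfl fun j hj => by
      rw [Function.update_of_ne (Finset.ne_of_mem_erase hj)]
  rw [this]
  ring

/-- Raising one coordinate of the greatest element of a superlevel set violates the demand there. -/
theorem powerMap_update_lt (hA : ∀ i j, i ≠ j → A i j ≤ 0) {q v : L → ℝ}
    (hv : IsGreatest (superlevel A b q) v) {i : L} {t : ℝ} (ht : v i < t) :
    powerMap A b (Function.update v i t) i < q i := by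
  by_contra! hcon
  have hle : v ≤ Function.update v i t := le_update_iff.2 ⟨ht.le, fun j _ => le_rfl⟩
  have hmem : Function.update v i t ∈ superlevel A b q := by
    refine ⟨hv.1.1.trans hle, fun j => ?_⟩
    by_cases hj : j = i
    · rw [hj]; exact hcon
    · exact (hv.1.2 j).trans
        (powerMap_le_of_eq hA hv.1.1 hle (by rw [Function.update_of_ne hj]))
  have := hv.2 hmem i
  rw [Function.update_self] at this
  linarith

/-- Raising a coordinate makes its power fall below demand; letting the raise tend to zero leaves no
surplus. -/
theorem powerMap_eq_of_isGreatest (hA : ∀ i j, i ≠ j → A i j ≤ 0) {q v : L → ℝ}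
    (hv : IsGreatest (superlevel A b q) v) : powerMap A b v = q := by
  ext i
  refine le_antisymm ?_ (hv.1.2 i)
  have hcont : Continuous fun t => powerMap A b (Function.update v i t) i := by
    simp only [powerMap_update]
    fun_prop
  have h1 : Filter.Tendsto (fun t => powerMap A b (Function.update v i t) i)
      (nhdsWithin (v i) (Set.Ioi (v i))) (nhds (powerMap A b v i)) := by
    have := (hcont.tendsto (v i)).mono_left (nhdsWithin_le_nhds (s := Set.Ioi (v i)))
    simpa using this
  refine le_of_tendsto h1 ?_
  filter_upwards [self_mem_nhdsWithin] with t ht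
  exact (powerMap_update_lt hA hv ht).le

theorem pos_of_isGreatest (hA : IsIrreducibleStieltjes H A) (hb : 0 ≤ b) (hb0 : b ≠ 0)
    {q v : L → ℝ} (hv : IsGreatest (superlevel A b q) v) : ∀ i, 0 < v i := by
  refine pos_of_zero_imp hA hb hb0 hv.1.1 fun i hi => ?_
  have hq : q i = 0 := by
    rw [← powerMap_eq_of_isGreatest hA.offDiag hv, powerMap, hi, zero_mul]
  set s := ∑ j ∈ Finset.univ.erase i, A i j * v j
  have hlim : Filter.Tendsto (fun t => b i - A i i * t) (nhdsWithin 0 (Set.Ioi 0))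
      (nhds (b i)) := by
    have : Continuous fun t => b i - A i i * t := by fun_prop
    simpa using (this.tendsto 0).mono_left (nhdsWithin_le_nhds (s := Set.Ioi 0))
  -- Raising the zero coordinate to `t > 0` gives power `t * (b i - A i i * t - s) < 0`; dividing by
  -- `t` and letting `t → 0` gives `b i ≤ s`.
  refine le_of_tendsto hlim ?_
  filter_upwards [self_mem_nhdsWithin] with t ht
  have h1 := powerMap_update_lt hA.offDiag hv (i := i) (t := t) (by rw [hi]; exact ht)
  rw [powerMap_update, hq] at h1
  by_contra! hcon
  have : 0 < t * (b i - A i i * t - s) := mul_pos ht (by linarith)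
  linarith

/-- The greatest solution for a demand that is strictly below an attainable one is stable. -/
theorem powerJacobian_of_isGreatest (hA : IsIrreducibleStieltjes H A) (hb : 0 ≤ b) (hb0 : b ≠ 0)
    {q v : L → ℝ} (hv : IsGreatest (superlevel A b q) v) {x : L → ℝ} (hx : 0 ≤ x)
    (hqx : ∀ i, q i < powerMap A b x i) :
    IsUnit (powerJacobian A b v) ∧ ∀ i j, (powerJacobian A b v)⁻¹ i j < 0 := by
  have hpos := pos_of_isGreatest hA hb hb0 hv
  have hxv : x ≤ v := hv.2 ⟨hx, fun i => (hqx i).le⟩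
  set M := -powerJacobian A b v with hMdef
  have hM : ∀ i j, i ≠ j → M i j = v i * A i j := fun i j hij => by
    rw [hMdef, neg_apply, powerJacobian_apply_ne hij, neg_neg]
  have hoff : ∀ i j, i ≠ j → M i j ≤ 0 := fun i j hij => by
    rw [hM i j hij]
    exact mul_nonpos_of_nonneg_of_nonpos (hpos i).le (hA.offDiag i j hij)
  have hadj : ∀ i j, H.Adj i j → M i j < 0 := fun i j hij => by
    rw [hM i j hij.ne]
    exact mul_neg_of_pos_of_neg (hpos i) (hA.adj i j hij)
  -- The difference of squared voltages, rescaled by the derivative `2 * v i` of the square: the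
  -- direction in the gradient inequality. That inequality gives `M *ᵥ u ≥ powerMap A b x - q > 0`.
  set u : L → ℝ := fun i => (v i ^ 2 - x i ^ 2) / (2 * v i)
  have hu : 0 ≤ u := fun i => by
    have := hpos i
    have h1 : x i ^ 2 ≤ v i ^ 2 := pow_le_pow_left₀ (hx i) (hxv i) 2
    exact div_nonneg (by linarith) (by positivity)
  have hMu : ∀ i, 0 < (M *ᵥ u) i := fun i => by
    have h1 := powerMap_sub_le hA.offDiag hb (v := x) hpos i
    have h2 : (fun i => (x i ^ 2 - v i ^ 2) / (2 * v i)) = -u := by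
      ext k
      simp only [u, Pi.neg_apply]
      ring
    rw [h2, mulVec_neg, ← neg_mulVec, ← hMdef, Pi.sub_apply,
      powerMap_eq_of_isGreatest hA.offDiag hv] at h1
    have := hqx i
    linarith
  have hunit := isUnit_of_mulVec_pos hoff hu hMu
  have hJ : powerJacobian A b v = -M := by rw [hMdef, neg_neg]
  rw [hJ]
  refine ⟨hunit.neg, fun i j => ?_⟩
  have hinv : (-M)⁻¹ = -M⁻¹ := by
    refine inv_eq_left_inv ?_
    rw [neg_mul_neg, nonsing_inv_mul _ ((isUnit_iff_isUnit_det M).1 hunit)]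
  rw [hinv, neg_apply, neg_lt_zero]
  exact inv_pos_of_mulVec_pos hA.connected hadj hoff hu hMu i j

end Superlevel

end LoadFlow

/-! ### The hypograph, the closure of the stable set, and separation -/

namespace LoadFlow

/-- The demands dominated by the power at a nonnegative voltage. -/
def hypograph {L : Type*} [Fintype L] (A : Matrix L L ℝ) (b : L → ℝ) : Set (L → ℝ) :=
  {q | (superlevel A b q).Nonempty}

/-- Relaxing the demand by `ε n` gives a decreasing sequence of nonempty compact superlevel sets,
and a common point meets the full demand. -/
theorem isClosed_hypograph {L : Type*} [Fintype L] {H : SimpleGraph L} {A : Matrix L L ℝ}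
    {b : L → ℝ} (hA : IsIrreducibleStieltjes H A) (hb : 0 ≤ b) :
    IsClosed (hypograph A b) := by
  refine isClosed_of_closure_subset fun q hq => ?_
  set ε : ℕ → ℝ := fun n => 1 / ((n : ℝ) + 1)
  have hε : ∀ n, 0 < ε n := fun n => Nat.one_div_pos_of_nat
  have hεlim : Filter.Tendsto ε Filter.atTop (nhds 0) := tendsto_one_div_add_atTop_nhds_zero_nat
  have hanti : Antitone ε := fun m n hmn => Nat.one_div_le_one_div hmn
  obtain ⟨x, hx⟩ := IsCompact.nonempty_iInter_of_sequence_nonempty_isCompact_isClosed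
    (fun n => superlevel A b fun i => q i - ε n)
    (fun n x hx => ⟨hx.1, fun i =>
      (sub_le_sub_left (hanti n.le_succ) (q i)).trans (hx.2 i)⟩)
    (fun n => by
      obtain ⟨p, ⟨x, hx, hpx⟩, hp⟩ := Metric.mem_closure_iff.1 hq (ε n) (hε n)
      refine ⟨x, hx, fun i => le_trans ?_ (hpx i)⟩
      have h1 : |q i - p i| < ε n := (dist_le_pi_dist q p i).trans_lt hp
      linarith [(abs_lt.1 h1).2])
    (isCompact_superlevel hA hb _)
    (fun n => (isCompact_superlevel hA hb _).isClosed)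
  rw [Set.mem_iInter] at hx
  refine ⟨x, (hx 0).1, fun i => ?_⟩
  have h2 : Filter.Tendsto (fun n => q i - ε n) Filter.atTop (nhds (q i)) := by
    simpa using hεlim.const_sub (q i)
  exact le_of_tendsto' h2 fun n => (hx n).2 i

variable {L : Type*} [Fintype L] [DecidableEq L] {H : SimpleGraph L} {A : Matrix L L ℝ}
  {b : L → ℝ}

/-- The positive voltages at which the inverse of the Jacobian matrix is negative. -/
def stableSet (A : Matrix L L ℝ) (b : L → ℝ) : Set (L → ℝ) :=
  {v | (∀ i, 0 < v i) ∧ IsUnit (powerJacobian A b v) ∧ ∀ i j, (powerJacobian A b v)⁻¹ i j < 0}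

theorem pos_of_mem_closure_stableSet (hA : IsIrreducibleStieltjes H A) (hb : 0 ≤ b) (hb0 : b ≠ 0)
    {v : L → ℝ} (hv : v ∈ closure (stableSet A b)) : ∀ i, 0 < v i := by
  -- Besides nonnegative voltages, `K` asks that the Jacobian have nonpositive diagonal. This closed
  -- condition holds at stable points, and at a zero voltage it is exactly the hypothesis of
  -- `pos_of_zero_imp`.
  set K : Set (L → ℝ) := {v | 0 ≤ v} ∩
    ⋂ i, {v | b i - ∑ j ∈ Finset.univ.erase i, A i j * v j ≤ 2 * (A i i * v i)}
  have hK : IsClosed K := by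
    exact (isClosed_le continuous_const continuous_id).inter
      (isClosed_iInter fun i => isClosed_le (by fun_prop) (by fun_prop))
  have hsub : stableSet A b ⊆ K := by
    rintro w ⟨hw, hunit, hinv⟩
    refine ⟨fun i => (hw i).le, Set.mem_iInter.2 fun i => ?_⟩
    have hoff : ∀ i j, i ≠ j → (-powerJacobian A b w) i j ≤ 0 := fun i j hij => by
      rw [Matrix.neg_apply, powerJacobian_apply_ne hij, neg_neg]
      exact mul_nonpos_of_nonneg_of_nonpos (hw i).le (hA.offDiag i j hij)
    have hneg : (-powerJacobian A b w)⁻¹ = -(powerJacobian A b w)⁻¹ := by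
      refine inv_eq_left_inv ?_
      rw [neg_mul_neg, nonsing_inv_mul _ ((isUnit_iff_isUnit_det _).1 hunit)]
    have h1 := diag_pos_of_inv_nonneg hoff hunit.neg (fun k l => by
      rw [hneg, Matrix.neg_apply]
      exact neg_nonneg.2 (hinv k l).le) i
    rw [Matrix.neg_apply, powerJacobian_apply_self] at h1
    rw [Set.mem_ofPred_eq]
    linarith
  obtain ⟨h0, h1⟩ := closure_minimal hsub hK hv
  refine pos_of_zero_imp hA hb hb0 h0 fun i hi => ?_
  have : b i - ∑ j ∈ Finset.univ.erase i, A i j * v j ≤ 2 * (A i i * v i) := Set.mem_iInter.1 h1 i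
  rw [hi] at this
  linarith

/-- The greatest elements for the demands `q - ε n` are stable, with `v` as strict witness, and
decrease to a limit above `v` that still meets `q`, hence to `v`. -/
theorem mem_closure_stableSet_of_isGreatest (hA : IsIrreducibleStieltjes H A) (hb : 0 ≤ b)
    (hb0 : b ≠ 0) {q v : L → ℝ} (hv : IsGreatest (superlevel A b q) v) :
    v ∈ closure (stableSet A b) := by
  set ε : ℕ → ℝ := fun n => 1 / ((n : ℝ) + 1)
  have hε : ∀ n, 0 < ε n := fun n => Nat.one_div_pos_of_nat
  have hεlim : Filter.Tendsto ε Filter.atTop (nhds 0) := tendsto_one_div_add_atTop_nhds_zero_nat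
  have hanti : Antitone ε := fun m n hmn => Nat.one_div_le_one_div hmn
  have hlt : ∀ n i, q i - ε n < powerMap A b v i := fun n i => by
    have h1 := hv.1.2 i
    have := hε n
    linarith
  have hex : ∀ n, ∃ w, IsGreatest (superlevel A b fun i => q i - ε n) w := fun n =>
    exists_isGreatest_superlevel hA hb ⟨v, hv.1.1, fun i => (hlt n i).le⟩
  choose w hw using hex
  have hvw : ∀ n, v ≤ w n := fun n => (hw n).2 ⟨hv.1.1, fun i => (hlt n i).le⟩
  have hwanti : Antitone w := fun m n hmn => (hw m).2 ⟨(hw n).1.1, fun i =>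
    (sub_le_sub_left (hanti hmn) (q i)).trans ((hw n).1.2 i)⟩
  have hbdd : BddBelow (Set.range w) := ⟨v, by rintro _ ⟨n, rfl⟩; exact hvw n⟩
  have hlim := tendsto_atTop_ciInf hwanti hbdd
  have hle : v ≤ ⨅ n, w n := le_ciInf hvw
  have hmem : (⨅ n, w n) ∈ superlevel A b q := by
    refine ⟨hv.1.1.trans hle, fun i => ?_⟩
    have h1 := ((continuous_apply i).comp (continuous_powerMap A b)).continuousAt.tendsto.comp hlim
    have h2 : Filter.Tendsto (fun n => q i - ε n) Filter.atTop (nhds (q i)) := by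
      simpa using hεlim.const_sub (q i)
    exact le_of_tendsto_of_tendsto' h2 h1 fun n => (hw n).1.2 i
  rw [le_antisymm hle (hv.2 hmem)]
  exact mem_closure_of_tendsto hlim (Filter.Eventually.of_forall fun n =>
    ⟨pos_of_isGreatest hA hb hb0 (hw n),
      powerJacobian_of_isGreatest hA hb hb0 (hw n) hv.1.1 (hlt n)⟩)

theorem convex_hypograph (hA : ∀ i j, i ≠ j → A i j ≤ 0) (hb : 0 ≤ b) :
    Convex ℝ (hypograph A b) := by
  rintro p ⟨x, hx, hpx⟩ q ⟨y, hy, hqy⟩ s t hs ht hst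
  refine ⟨_, fun i => Real.sqrt_nonneg _,
    le_trans ?_ (combo_le_powerMap_sqrt hA hb x y hs ht hst)⟩
  gcongr

/-- A weight for which the weighted power is bounded above on nonnegative voltages is positive,
and the associated quadratic form is positive definite. -/
theorem posDef_weighted_of_bddAbove (hA : IsIrreducibleStieltjes H A) (hb : 0 ≤ b) (hb0 : b ≠ 0)
    {l : L → ℝ} (hl : 0 ≤ l) (hl0 : l ≠ 0) {c : ℝ}
    (hc : ∀ x, 0 ≤ x → l ⬝ᵥ powerMap A b x ≤ c) :
    (∀ i, 0 < l i) ∧ (weighted A l).PosDef := by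
  have hoff := weighted_offDiag_nonpos hA.offDiag hl
  have hray : ∀ x : L → ℝ, 0 ≤ x → ∀ t : ℝ, 0 ≤ t →
      t * ∑ i, l i * b i * x i - t ^ 2 * (x ⬝ᵥ (weighted A l *ᵥ x)) ≤ c := fun x hx t ht => by
    refine le_trans (le_of_eq ?_) (hc (t • x) (smul_nonneg ht hx))
    rw [dotProduct_powerMap hA.isSymm, mulVec_smul, smul_dotProduct, dotProduct_smul,
      Finset.mul_sum]
    simp only [smul_eq_mul, Pi.smul_apply]
    congr 1
    · exact Finset.sum_congr rfl fun i _ => by ring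
    · ring
  have hlin : ∀ x : L → ℝ, 0 ≤ x → 0 ≤ ∑ i, l i * b i * x i := fun x hx =>
    Finset.sum_nonneg fun i _ => mul_nonneg (mul_nonneg (hl i) (hb i)) (hx i)
  have hc0 : 0 ≤ c := by simpa using hray 0 le_rfl 0 le_rfl
  have hnonneg : ∀ x, 0 ≤ x ⬝ᵥ (weighted A l *ᵥ x) := fun x => by
    refine le_trans ?_ (abs_dotProduct_mulVec_abs_le hoff x)
    by_contra! hneg
    set a := |x| ⬝ᵥ (weighted A l *ᵥ |x|)
    -- At a negative form value `a`, this scale makes `t ^ 2 * (-a)` exceed `c`; adding `1` to `c`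
    -- keeps the excess strict.
    have h1 := hray |x| (abs_nonneg x) (1 + (c + 1) / (-a))
      (by have : 0 < -a := by linarith
          positivity)
    have h2 := hlin |x| (abs_nonneg x)
    have h3 : 0 ≤ (c + 1) / (-a) := div_nonneg (by linarith) (by linarith)
    have h4 : (c + 1) / (-a) * (-a) = c + 1 := div_mul_cancel₀ _ (by linarith)
    set r := (c + 1) / (-a)
    have h5 : 0 ≤ (1 + r) * ∑ i, l i * b i * |x| i := by positivity
    nlinarith [mul_nonneg h3 (mul_nonneg h3 (by linarith : 0 ≤ -a))]
  have hherm : (weighted A l).IsHermitian := by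
    rw [IsHermitian, conjTranspose_eq_transpose_of_trivial]
    exact weighted_isSymm hA.isSymm l
  have hpsd : (weighted A l).PosSemidef :=
    PosSemidef.of_dotProduct_mulVec_nonneg hherm fun x => by simpa using hnonneg x
  have hker : ∀ x, x ⬝ᵥ (weighted A l *ᵥ x) = 0 → weighted A l *ᵥ x = 0 := fun x hx =>
    (hpsd.dotProduct_mulVec_zero_iff x).1 (by simpa using hx)
  -- If `l k = 0`, the diagonal entry at `k` vanishes, so semidefiniteness kills column `k`; its
  -- entry `l j / 2 * A j k` then forces `l j = 0` at each neighbour.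
  have hlpos : ∀ i, 0 < l i := by
    intro i
    refine (hl i).lt_of_ne fun hi => hl0 (funext ?_)
    refine forall_of_connected hA.connected (p := fun k => l k = 0) (fun k j hkj hk => ?_) hi.symm
    have h1 : weighted A l *ᵥ Pi.single k 1 = 0 := hker _ (by simp [weighted_apply, hk])
    have h2 := congrFun h1 j
    simp only [mulVec_single_one, col_apply, weighted_apply, Pi.zero_apply, hk] at h2
    have := (hA.adj j k hkj.symm).ne
    simpa [this] using h2
  refine ⟨hlpos, PosDef.of_dotProduct_mulVec_pos hherm fun x hx => ?_⟩
  simp only [star_trivial]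
  refine (hnonneg x).lt_of_ne fun h0 => hx ?_
  have habs0 : |x| ⬝ᵥ (weighted A l *ᵥ |x|) = 0 :=
    le_antisymm ((abs_dotProduct_mulVec_abs_le hoff x).trans h0.ge) (hnonneg _)
  have hmul := hker _ habs0
  -- The quadratic term vanishes along the ray of `|x|`, so boundedness forces the linear term to
  -- vanish too. Thus `x` is zero where `b` is not, and the kernel equation spreads this zero.
  have hlin0 : ∑ i, l i * b i * |x| i = 0 := by
    refine le_antisymm ?_ (hlin |x| (abs_nonneg x))
    by_contra! hpos
    have h1 := hray |x| (abs_nonneg x) ((c + 1) / ∑ i, l i * b i * |x| i) (by positivity)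
    rw [habs0, div_mul_cancel₀ _ hpos.ne'] at h1
    linarith
  have hbx : ∀ i, b i * |x i| = 0 := fun i => by
    have h1 := (Finset.sum_eq_zero_iff_of_nonneg fun i _ =>
      mul_nonneg (mul_nonneg (hl i) (hb i)) (abs_nonneg (x i))).1 hlin0 i (Finset.mem_univ i)
    rw [mul_assoc] at h1
    exact (mul_eq_zero.1 h1).resolve_left (hlpos i).ne'
  obtain ⟨k, hk⟩ : ∃ k, b k ≠ 0 := Function.ne_iff.1 hb0
  have hall : ∀ j, |x| j = 0 := by
    refine forall_of_connected hA.connected (p := fun k => |x| k = 0) (fun i j hij hi => ?_)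
      ((mul_eq_zero.1 (hbx k)).resolve_left hk)
    refine eq_zero_of_adj hoff (fun i j hij => ?_) (abs_nonneg x) hij ?_
    · rw [weighted_apply]
      have h1 := hlpos i
      have h2 := hlpos j
      exact mul_neg_of_pos_of_neg (by positivity) (hA.adj i j hij)
    · have := congrFun hmul i
      rw [mulVec_eq_diag_add, hi, mul_zero, zero_add] at this
      exact this.ge
  exact funext fun j => abs_eq_zero.1 (hall j)

/-- Demands satisfying all the weighted power bounds are dominated by an attainable demand. -/
theorem mem_hypograph_of_forall_weight (hA : IsIrreducibleStieltjes H A) (hb : 0 ≤ b)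
    (hb0 : b ≠ 0) {p : L → ℝ}
    (hp : ∀ l : L → ℝ, (∀ i, 0 < l i) → ∑ i, l i = 1 → (weighted A l).PosDef →
      ∃ x, l ⬝ᵥ p ≤ l ⬝ᵥ powerMap A b x) : p ∈ hypograph A b := by
  by_contra hnot
  obtain ⟨f, c, hfc, hcp⟩ := geometric_hahn_banach_closed_point
    (convex_hypograph hA.offDiag hb) (isClosed_hypograph hA hb) hnot
  set l : L → ℝ := fun i => f (Pi.single i 1)
  have hf : ∀ y, f y = l ⬝ᵥ y := fun y => by
    conv_lhs => rw [pi_eq_sum_univ' y]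
    simp [l, dotProduct, mul_comm]
  have hdown : ∀ y ∈ hypograph A b, ∀ z, z ≤ y → z ∈ hypograph A b :=
    fun y ⟨x, hx, hyx⟩ z hz => ⟨x, hx, hz.trans hyx⟩
  have h0 : (0 : L → ℝ) ∈ hypograph A b := ⟨0, le_rfl, by intro i; simp [powerMap]⟩
  have hc0 : 0 < c := by simpa using hfc 0 h0
  have hl : 0 ≤ l := fun i => by
    -- The vector `Pi.single i (c / l i)` is nonpositive, hence in the hypograph, yet `f` takes the
    -- value `c` there.
    by_contra! hneg
    have hneg' : l i < 0 := hneg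
    have h1 := hfc (Pi.single i (c / l i)) (hdown 0 h0 _
      (Pi.single_nonpos.2 (div_nonpos_of_nonneg_of_nonpos hc0.le hneg'.le)))
    rw [hf, dotProduct_single, mul_div_cancel₀ _ hneg'.ne] at h1
    exact lt_irrefl _ h1
  have hl0 : l ≠ 0 := fun h => by
    rw [hf, h, zero_dotProduct] at hcp
    linarith
  have hbound : ∀ x, 0 ≤ x → l ⬝ᵥ powerMap A b x ≤ c := fun x hx => by
    rw [← hf]
    exact (hfc _ ⟨x, hx, le_rfl⟩).le
  set s := ∑ i, l i
  have hs : 0 < s := by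
    refine (Finset.sum_nonneg fun i _ => hl i).lt_of_ne fun h => hl0 (funext fun i => ?_)
    exact (Finset.sum_eq_zero_iff_of_nonneg fun i _ => hl i).1 h.symm i (Finset.mem_univ i)
  have hl' : 0 ≤ s⁻¹ • l := smul_nonneg (inv_nonneg.2 hs.le) hl
  obtain ⟨hpos, hpd⟩ := posDef_weighted_of_bddAbove hA hb hb0 hl'
    (smul_ne_zero (inv_ne_zero hs.ne') hl0) (c := s⁻¹ * c) fun x hx => by
      rw [smul_dotProduct, smul_eq_mul]
      exact mul_le_mul_of_nonneg_left (hbound x hx) (inv_nonneg.2 hs.le)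
  obtain ⟨x, hx⟩ := hp _ hpos (by
    simp only [Pi.smul_apply, smul_eq_mul, ← Finset.mul_sum]
    exact inv_mul_cancel₀ hs.ne') hpd
  have h1 := hx.trans (dotProduct_powerMap_le_abs hA.isSymm hA.offDiag hb hl' x)
  rw [smul_dotProduct, smul_dotProduct, smul_eq_mul, smul_eq_mul] at h1
  have h2 := (le_of_mul_le_mul_left h1 (inv_pos.2 hs)).trans (hbound _ (abs_nonneg x))
  rw [hf] at hcp
  linarith

theorem exists_mem_closure_stableSet (hA : IsIrreducibleStieltjes H A) (hb : 0 ≤ b) (hb0 : b ≠ 0)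
    {p : L → ℝ} (hp : p ∈ hypograph A b) :
    ∃ v ∈ closure (stableSet A b), powerMap A b v = p := by
  obtain ⟨v, hv⟩ := exists_isGreatest_superlevel hA hb hp
  exact ⟨v, mem_closure_stableSet_of_isGreatest hA hb hb0 hv,
    powerMap_eq_of_isGreatest hA.offDiag hv⟩

/-- The value of a concave quadratic function is at most its value at the critical point. -/
theorem dotProduct_powerMap_eq_sub (hsymm : A.IsSymm) {l φ : L → ℝ}
    (hφ : (2 : ℝ) • (weighted A l *ᵥ φ) = fun i => l i * b i) (x : L → ℝ) :
    l ⬝ᵥ powerMap A b x = φ ⬝ᵥ (weighted A l *ᵥ φ)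
      - (x - φ) ⬝ᵥ (weighted A l *ᵥ (x - φ)) := by
  have h1 : ∑ i, l i * b i * x i = 2 * (x ⬝ᵥ (weighted A l *ᵥ φ)) := by
    rw [← smul_eq_mul, ← dotProduct_smul, hφ]
    exact Finset.sum_congr rfl fun i _ => by ring
  have h2 : φ ⬝ᵥ (weighted A l *ᵥ x) = x ⬝ᵥ (weighted A l *ᵥ φ) := by
    rw [dotProduct_mulVec, ← mulVec_transpose, (weighted_isSymm hsymm l).eq, dotProduct_comm]
  rw [dotProduct_powerMap hsymm, h1, mulVec_sub, sub_dotProduct, dotProduct_sub, dotProduct_sub, h2]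
  ring

end LoadFlow

/-! ### The grid as an instance, and the four inclusions -/

namespace DCGrid

variable {L S : Type*} [Fintype L] [Fintype S] [DecidableEq L] [DecidableEq S]

open Classical in
/-- The conductance between two nodes, zero if there is no line. -/
noncomputable def conductance {L S : Type*} (G : DCGrid L S) (i j : L ⊕ S) : ℝ :=
  if G.graph.Adj i j then G.w i j else 0

theorem conductance_comm {L S : Type*} (G : DCGrid L S) (i j : L ⊕ S) :
    G.conductance i j = G.conductance j i := by
  unfold conductance
  by_cases h : G.graph.Adj i j
  · rw [if_pos h, if_pos h.symm, G.w_symm i j h]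
  · rw [if_neg h, if_neg fun h' => h h'.symm]

theorem conductance_pos {L S : Type*} (G : DCGrid L S) {i j : L ⊕ S} (h : G.graph.Adj i j) :
    0 < G.conductance i j := by
  rw [conductance, if_pos h]
  exact G.w_pos i j h

theorem conductance_nonneg {L S : Type*} (G : DCGrid L S) (i j : L ⊕ S) :
    0 ≤ G.conductance i j := by
  by_cases h : G.graph.Adj i j
  · exact (G.conductance_pos h).le
  · rw [conductance, if_neg h]

theorem Y_apply_ne (G : DCGrid L S) {i j : L ⊕ S} (hij : i ≠ j) :
    G.Y i j = -G.conductance i j := by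
  rw [Y, of_apply, if_neg hij, conductance]
  split_ifs <;> simp

theorem Y_apply_self (G : DCGrid L S) (i : L ⊕ S) : G.Y i i = ∑ k, G.conductance i k := by
  rw [Y, of_apply, if_pos rfl]
  refine Finset.sum_congr rfl fun k _ => ?_
  by_cases hik : G.graph.Adj i k
  · rw [conductance, if_pos hik, if_pos hik.symm]
  · rw [conductance, if_neg hik, if_neg fun h => hik h.symm]

theorem YLL_apply_ne (G : DCGrid L S) {i j : L} (hij : i ≠ j) :
    G.YLL i j = -G.conductance (.inl i) (.inl j) :=
  G.Y_apply_ne fun h => hij (Sum.inl_injective h)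

theorem YLL_apply_self (G : DCGrid L S) (i : L) :
    G.YLL i i = ∑ k, G.conductance (.inl i) (.inl k) + ∑ k, G.conductance (.inl i) (.inr k) := by
  rw [← Fintype.sum_sum_type (fun k => G.conductance (.inl i) k)]
  exact G.Y_apply_self _

theorem YLL_eq (G : DCGrid L S) :
    G.YLL = diagonal (fun i => ∑ k, G.conductance (.inl i) (.inl k)
        + ∑ k, G.conductance (.inl i) (.inr k))
      - of fun i j => G.conductance (.inl i) (.inl j) := by
  ext i j
  rw [Matrix.sub_apply, of_apply]
  by_cases hij : i = j
  · subst hij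
    have : G.conductance (.inl i) (.inl i) = 0 := if_neg (G.graph.irrefl)
    rw [diagonal_apply_eq, this, YLL_apply_self, sub_zero]
  · rw [diagonal_apply_ne _ hij, YLL_apply_ne G hij, zero_sub]

theorem YLL_isSymm (G : DCGrid L S) : G.YLL.IsSymm := by
  ext i j
  rw [transpose_apply]
  by_cases hij : i = j
  · rw [hij]
  · rw [YLL_apply_ne G hij, YLL_apply_ne G (Ne.symm hij), conductance_comm]

/-- The power dissipated in the lines when all the sources are grounded. -/
theorem dotProduct_YLL_mulVec (G : DCGrid L S) (x : L → ℝ) :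
    x ⬝ᵥ (G.YLL *ᵥ x) = ∑ i, (∑ k, G.conductance (.inl i) (.inr k)) * x i ^ 2
      + 1 / 2 * ∑ i, ∑ j, G.conductance (.inl i) (.inl j) * (x i - x j) ^ 2 := by
  have hswap : ∑ i, ∑ j, G.conductance (.inl i) (.inl j) * x j ^ 2
      = ∑ i, ∑ j, G.conductance (.inl i) (.inl j) * x i ^ 2 := by
    rw [Finset.sum_comm]
    exact Finset.sum_congr rfl fun i _ => Finset.sum_congr rfl fun j _ => by
      rw [conductance_comm]
  have hsq : ∑ i, ∑ j, G.conductance (.inl i) (.inl j) * (x i - x j) ^ 2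
      = ∑ i, ∑ j, G.conductance (.inl i) (.inl j) * x i ^ 2
        + ∑ i, ∑ j, G.conductance (.inl i) (.inl j) * x j ^ 2
        - 2 * ∑ i, ∑ j, G.conductance (.inl i) (.inl j) * (x i * x j) := by
    simp only [Finset.mul_sum, ← Finset.sum_add_distrib, ← Finset.sum_sub_distrib]
    exact Finset.sum_congr rfl fun i _ => Finset.sum_congr rfl fun j _ => by ring
  have hform : x ⬝ᵥ (G.YLL *ᵥ x) = ∑ i, (∑ k, G.conductance (.inl i) (.inr k)) * x i ^ 2
      + ∑ i, ∑ j, G.conductance (.inl i) (.inl j) * x i ^ 2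
      - ∑ i, ∑ j, G.conductance (.inl i) (.inl j) * (x i * x j) := by
    rw [YLL_eq, sub_mulVec, dotProduct_sub]
    congr 1
    · rw [← Finset.sum_add_distrib]
      refine Finset.sum_congr rfl fun i _ => ?_
      rw [mulVec_diagonal, ← Finset.sum_mul]
      ring
    · refine Finset.sum_congr rfl fun i _ => ?_
      simp only [mulVec, dotProduct, of_apply, Finset.mul_sum]
      exact Finset.sum_congr rfl fun j _ => by ring
  rw [hform, hsq, hswap]
  ring

theorem exists_load_adj_source {L S : Type*} [Nonempty L] [Nonempty S] (G : DCGrid L S) :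
    ∃ (i : L) (s : S), G.graph.Adj (.inl i) (.inr s) := by
  by_contra! hno
  obtain ⟨i⟩ := ‹Nonempty L›
  obtain ⟨s⟩ := ‹Nonempty S›
  have h := LoadFlow.forall_of_connected G.connected (p := fun k => k.isLeft = true)
    (fun k l hkl hk => by
      obtain ⟨a, rfl⟩ := Sum.isLeft_iff.1 hk
      rcases l with c | c
      · rfl
      · exact absurd hkl (hno a c)) (i := .inl i) rfl (.inr s)
  simp at h

/-- If no power is dissipated, the voltage vanishes at a load joined to a source and is constant
along load lines, hence is zero. -/
theorem YLL_posDef [Nonempty S] (G : DCGrid L S) (hload : G.loadGraph.Connected) :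
    G.YLL.PosDef := by
  have : Nonempty L := hload.nonempty
  refine PosDef.of_dotProduct_mulVec_pos ?_ fun x hx => ?_
  · rw [IsHermitian, conjTranspose_eq_transpose_of_trivial]
    exact G.YLL_isSymm
  rw [star_trivial, dotProduct_YLL_mulVec]
  have h1 : ∀ i ∈ Finset.univ, 0 ≤ (∑ k, G.conductance (.inl i) (.inr k)) * x i ^ 2 := fun i _ =>
    mul_nonneg (Finset.sum_nonneg fun k _ => G.conductance_nonneg _ _) (sq_nonneg _)
  have h2 : ∀ i, ∀ j ∈ Finset.univ, 0 ≤ G.conductance (.inl i) (.inl j) * (x i - x j) ^ 2 :=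
    fun i j _ => mul_nonneg (G.conductance_nonneg _ _) (sq_nonneg _)
  have h3 : ∀ i ∈ Finset.univ, 0 ≤ ∑ j, G.conductance (.inl i) (.inl j) * (x i - x j) ^ 2 :=
    fun i _ => Finset.sum_nonneg (h2 i)
  have h1' := Finset.sum_nonneg h1
  have h3' := Finset.sum_nonneg h3
  refine lt_of_le_of_ne (by positivity) fun h0 => hx ?_
  have z1 := (Finset.sum_eq_zero_iff_of_nonneg h1).1 (by linarith)
  have z3 := (Finset.sum_eq_zero_iff_of_nonneg h3).1 (by linarith)
  obtain ⟨i, s, his⟩ := G.exists_load_adj_source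
  have hi : x i = 0 := by
    have hpos : 0 < ∑ k, G.conductance (.inl i) (.inr k) :=
      Finset.sum_pos' (fun k _ => G.conductance_nonneg _ _)
        ⟨s, Finset.mem_univ s, G.conductance_pos his⟩
    exact pow_eq_zero_iff two_ne_zero |>.1
      ((mul_eq_zero.1 (z1 i (Finset.mem_univ i))).resolve_left hpos.ne')
  refine funext (LoadFlow.forall_of_connected hload (p := fun k => x k = 0)
    (fun k l hkl hk => ?_) hi)
  have h4 := (Finset.sum_eq_zero_iff_of_nonneg (h2 k)).1 (z3 k (Finset.mem_univ k)) l
    (Finset.mem_univ l)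
  have h5 := (mul_eq_zero.1 h4).resolve_left (G.conductance_pos hkl).ne'
  have h6 := (pow_eq_zero_iff two_ne_zero).1 h5
  linarith

theorem isIrreducibleStieltjes_YLL [Nonempty S] (G : DCGrid L S)
    (hload : G.loadGraph.Connected) : LoadFlow.IsIrreducibleStieltjes G.loadGraph G.YLL where
  connected := hload
  isSymm := G.YLL_isSymm
  offDiag i j hij := by
    rw [YLL_apply_ne G hij]
    exact neg_nonpos.2 (G.conductance_nonneg _ _)
  adj i j hij := by
    rw [YLL_apply_ne G hij.ne]
    exact neg_neg_of_pos (G.conductance_pos hij)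
  posDef := G.YLL_posDef hload

theorem sourceCurrents_apply (G : DCGrid L S) (VS : S → ℝ) (i : L) :
    G.sourceCurrents VS i = ∑ s, G.conductance (.inl i) (.inr s) * VS s := by
  rw [sourceCurrents, Pi.neg_apply, mulVec, dotProduct, ← Finset.sum_neg_distrib]
  refine Finset.sum_congr rfl fun s _ => ?_
  have : G.YLS i s = -G.conductance (.inl i) (.inr s) := G.Y_apply_ne Sum.inl_ne_inr
  rw [this]
  ring

theorem sourceCurrents_nonneg (G : DCGrid L S) {VS : S → ℝ} (hVS : ∀ i, 0 < VS i) :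
    0 ≤ G.sourceCurrents VS := fun i => by
  rw [sourceCurrents_apply]
  exact Finset.sum_nonneg fun s _ => mul_nonneg (G.conductance_nonneg _ _) (hVS s).le

theorem sourceCurrents_ne_zero [Nonempty L] [Nonempty S] (G : DCGrid L S) {VS : S → ℝ}
    (hVS : ∀ i, 0 < VS i) : G.sourceCurrents VS ≠ 0 := fun h => by
  obtain ⟨i, s, his⟩ := G.exists_load_adj_source
  have hpos : 0 < G.sourceCurrents VS i := by
    rw [sourceCurrents_apply]
    exact Finset.sum_pos' (fun s _ => mul_nonneg (G.conductance_nonneg _ _) (hVS s).le)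
      ⟨s, Finset.mem_univ s, mul_pos (G.conductance_pos his) (hVS s)⟩
  rw [h] at hpos
  exact lt_irrefl _ hpos

theorem Pc_eq_powerMap [Nonempty S] (G : DCGrid L S) (hload : G.loadGraph.Connected)
    (VS : S → ℝ) : G.Pc VS = LoadFlow.powerMap G.YLL (G.sourceCurrents VS) := by
  have hdet := (isUnit_iff_isUnit_det _).1 (G.YLL_posDef hload).isUnit
  ext V i
  rw [Pc, LoadFlow.powerMap, ← mulVec_mulVec, mulVec_diagonal, mulVec_sub, openCircuitVoltages,
    mulVec_mulVec, mul_nonsing_inv _ hdet, one_mulVec, Pi.sub_apply]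

theorem jacobian_eq_powerJacobian [Nonempty S] (G : DCGrid L S) (hload : G.loadGraph.Connected)
    (VS : S → ℝ) (V : L → ℝ) :
    G.jacobian VS V = LoadFlow.powerJacobian G.YLL (G.sourceCurrents VS) V := by
  rw [jacobian, G.Pc_eq_powerMap hload, (LoadFlow.hasFDerivAt_powerMap _ _ V).fderiv]
  exact LinearMap.toMatrix'_toLin' _

theorem isOperatingPoint_iff (G : DCGrid L S) (VS : S → ℝ) (V p : L → ℝ) :
    G.IsOperatingPoint VS V p ↔ (∀ i, 0 < V i) ∧ G.Pc VS V = p := by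
  rw [IsOperatingPoint, Pc, ← neg_sub V, mulVec_neg, neg_eq_iff_add_eq_zero]

theorem stablePoints_eq [Nonempty S] (G : DCGrid L S) (hload : G.loadGraph.Connected)
    (VS : S → ℝ) :
    G.stablePoints VS = LoadFlow.stableSet G.YLL (G.sourceCurrents VS) := by
  ext V
  constructor
  · rintro ⟨p, hop, hJ⟩
    rw [G.jacobian_eq_powerJacobian hload] at hJ
    exact ⟨hop.1, hJ⟩
  · rintro ⟨hpos, hJ⟩
    rw [← G.jacobian_eq_powerJacobian hload] at hJ
    exact ⟨_, (G.isOperatingPoint_iff VS V _).2 ⟨hpos, rfl⟩, hJ⟩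

/-- This is the critical point equation of the weighted power, so `phi` is its maximizer. -/
theorem two_smul_h_mulVec_phi (G : DCGrid L S) (VS : S → ℝ) {l : L → ℝ} (hl : l ∈ G.Lam) :
    (2 : ℝ) • (G.h l *ᵥ G.phi VS l) = fun i => l i * G.sourceCurrents VS i := by
  have hdet := (isUnit_iff_isUnit_det _).1 (PosDef.isUnit hl)
  rw [phi, mulVec_smul, smul_smul, mulVec_mulVec, ← mul_assoc, mul_nonsing_inv _ hdet, one_mul]
  ext i
  simp [mulVec_diagonal]

theorem hNorm_sq (G : DCGrid L S) {l : L → ℝ} (hl : l ∈ G.Lam) (x : L → ℝ) :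
    G.hNorm l x ^ 2 = x ⬝ᵥ (G.h l *ᵥ x) :=
  Real.sq_sqrt (by simpa using (PosDef.posSemidef hl).dotProduct_mulVec_nonneg x)

theorem dotProduct_powerMap_eq (G : DCGrid L S) (VS : S → ℝ) {l : L → ℝ} (hl : l ∈ G.Lam)
    (x : L → ℝ) :
    l ⬝ᵥ LoadFlow.powerMap G.YLL (G.sourceCurrents VS) x
      = G.hNorm l (G.phi VS l) ^ 2 - G.hNorm l (x - G.phi VS l) ^ 2 := by
  rw [hNorm_sq G hl, hNorm_sq G hl]
  exact LoadFlow.dotProduct_powerMap_eq_sub G.YLL_isSymm (G.two_smul_h_mulVec_phi VS hl) x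

theorem range_Pc_subset [Nonempty S] (G : DCGrid L S) (hload : G.loadGraph.Connected)
    (VS : S → ℝ) : Set.range (G.Pc VS) ⊆ ⋂ l ∈ G.Lam₁, G.halfSpace VS l := by
  rintro _ ⟨x, rfl⟩
  refine Set.mem_iInter₂.2 fun l hl => ?_
  rw [G.Pc_eq_powerMap hload]
  exact (G.dotProduct_powerMap_eq VS hl.1 x).trans_le (sub_le_self _ (sq_nonneg _))

theorem iInter_halfSpace_subset [Nonempty S] (G : DCGrid L S) (hload : G.loadGraph.Connected)
    {VS : S → ℝ} (hVS : ∀ i, 0 < VS i) :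
    ⋂ l ∈ G.Lam₁, G.halfSpace VS l ⊆ G.Pc VS '' closure (G.stablePoints VS) := by
  intro p hp
  have : Nonempty L := hload.nonempty
  have hA := G.isIrreducibleStieltjes_YLL hload
  have hb := G.sourceCurrents_nonneg hVS
  have hb0 := G.sourceCurrents_ne_zero hVS
  rw [G.stablePoints_eq hload, G.Pc_eq_powerMap hload]
  refine LoadFlow.exists_mem_closure_stableSet hA hb hb0
    (LoadFlow.mem_hypograph_of_forall_weight hA hb hb0 fun l hl hsum hpd => ⟨G.phi VS l, ?_⟩)
  have hmem : l ∈ G.Lam₁ := ⟨hpd, hl, by simpa only [abs_of_pos (hl _)] using hsum⟩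
  -- The half-space bound is attained at `phi`, so it is a weighted power bound.
  rw [G.dotProduct_powerMap_eq VS hmem.1, sub_self]
  have h0 : G.hNorm l 0 = 0 := by simp [hNorm]
  rw [h0]
  have h1 : l ⬝ᵥ p ≤ G.hNorm l (G.phi VS l) ^ 2 := Set.mem_iInter₂.1 hp l hmem
  linarith

theorem image_closure_stablePoints_subset [Nonempty S] (G : DCGrid L S)
    (hload : G.loadGraph.Connected) {VS : S → ℝ} (hVS : ∀ i, 0 < VS i) :
    G.Pc VS '' closure (G.stablePoints VS) ⊆ G.feasible VS := by
  have : Nonempty L := hload.nonempty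
  rintro _ ⟨V, hV, rfl⟩
  rw [G.stablePoints_eq hload] at hV
  exact ⟨V, (G.isOperatingPoint_iff VS V _).2 ⟨LoadFlow.pos_of_mem_closure_stableSet
    (G.isIrreducibleStieltjes_YLL hload) (G.sourceCurrents_nonneg hVS)
    (G.sourceCurrents_ne_zero hVS) hV, rfl⟩⟩

theorem feasible_subset_range (G : DCGrid L S) (VS : S → ℝ) :
    G.feasible VS ⊆ Set.range (G.Pc VS) := by
  rintro p ⟨V, hV⟩
  exact ⟨V, ((G.isOperatingPoint_iff VS V p).1 hV).2⟩

theorem isClosed_halfSpace (G : DCGrid L S) (VS : S → ℝ) (l : L → ℝ) :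
    IsClosed (G.halfSpace VS l) :=
  isClosed_le (by fun_prop) continuous_const

theorem convex_halfSpace (G : DCGrid L S) (VS : S → ℝ) (l : L → ℝ) :
    Convex ℝ (G.halfSpace VS l) :=
  convex_halfSpace_le ⟨dotProduct_add l, fun c x => dotProduct_smul c l x⟩ _

end DCGrid

theorem mainTheorem2 {L S : Type*} [Fintype L] [Fintype S] [DecidableEq L] [DecidableEq S]
    [Nonempty S] (G : DCGrid L S) (hload : G.loadGraph.Connected)
    (VS : S → ℝ) (hVS : ∀ i, 0 < VS i) :
    IsClosed (G.feasible VS) ∧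
    Convex ℝ (G.feasible VS) ∧
    G.feasible VS = G.Pc VS '' closure (G.stablePoints VS) ∧
    G.feasible VS = closure (convexHull ℝ (G.feasible VS)) ∧
    G.feasible VS = ⋂ l ∈ G.Lam₁, G.halfSpace VS l ∧
    G.feasible VS = Set.range (G.Pc VS) := by
  have h1 := G.feasible_subset_range VS
  have h2 := G.range_Pc_subset hload VS
  have h3 := G.iInter_halfSpace_subset hload hVS
  have h4 := G.image_closure_stablePoints_subset hload hVS
  have hF := (h1.trans h2).antisymm (h3.trans h4)
  have hclosed : IsClosed (G.feasible VS) := by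
    rw [hF]
    exact isClosed_biInter fun l _ => G.isClosed_halfSpace VS l
  have hconvex : Convex ℝ (G.feasible VS) := by
    rw [hF]
    exact convex_iInter₂ fun l _ => G.convex_halfSpace VS l
  refine ⟨hclosed, hconvex, (h1.trans (h2.trans h3)).antisymm h4, ?_, hF,
    h1.antisymm (h2.trans (h3.trans h4))⟩
  rw [hconvex.convexHull_eq, hclosed.closure_eq]
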